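/- Let $\mathbb K$ be a field of characteristic zero, let $n\ge 1$, and let $d_0,\dots,d_n$ be positive integers (weights) with $\gcd(d_0,\dots,d_n)=1$. Let $\mathbf D=\mathbb K\langle x_0,\dots,x_n,\partial_0,\dots,\partial_n\rangle$ be the Weyl algebra, graded by $\deg x_i=d_i$, $\deg\partial_i=-d_i$; let $\mathbf D_0$ be its subalgebra of elements of degree $0$, let $\mathbf A=\mathbb K[x_0,\dots,x_n]=\bigoplus_{k\ge 0}\mathbf A_k\subset\mathbf D$ with the induced grading, and let $\mathbf E=\sum_i d_i x_i\partial_i\in\mathbf D_0$ be the Euler field, which is central in $\mathbf D_0$. For a left $\mathbf D$-module $M$ and $\mu\in\mathbb K$ put $M^\mu=\{m\in M: \mathbf E m=\mu m\}$. Fix $\lambda\in\mathbb K$. A left $\mathbf D$-module $M$ is called $\lambda$-Euler if $M=\bigoplus_{k\in\mathbb Z}M^{\lambda+k}$; it is then canonically $\mathbb Z$-graded by $M_k=M^{\lambda+k}$, and the $\lambda$-Euler modules with the $\mathbf D$-linear maps form a category $\mathbf D\text{-}\mathrm{Gr}^\lambda$. Such an $M$ is torsion if for every $m\in M$ there is an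 $N$ with $\mathbf A_k m=0$ for all $k>N$; the torsion modules form a Serre subcategory $\mathbf D\text{-}\mathrm{Tors}^\lambda$. The category of $\lambda$-twisted D-modules on the weighted projective stack $[\mathbb P(V)]=[(V\setminus\{0\})/\mathbb G_m]$, where $V$ has dimension $n+1$ and weights $d_0,\dots,d_n$, is by definition the Serre quotient $$\mathcal D^\lambda_{[X]}\text{-}\mathrm{Qcoh}=\mathbf D\text{-}\mathrm{Gr}^\lambda/\mathbf D\text{-}\mathrm{Tors}^\lambda .$$ Let $\pi_\lambda:\mathbf D\text{-}\mathrm{Gr}^\lambda\to\mathcal D^\lambda_{[X]}\text{-}\mathrm{Qcoh}$ be the quotient functor and $\omega_\lambda$ its right adjoint (the section functor). The global sections functor is $$\Gamma_\lambda:\mathcal D^\lambda_{[X]}\text{-}\mathrm{Qcoh}\to (D^\lambda_{[X]})_0\text{-}\mathrm{Mod},\qquad \Gamma_\lambda(\mathcal M)=\omega_\lambda(\mathcal M)_0=\omega_\lambda(\mathcal M)^\lambda,$$ where $(D^\lambda_{[X]})_0=\mathbf D_0/\mathbf D_0(\mathbf E-\lambda)$. Let $\mathcal A=\{\sum_i a_i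 d_i : a_i\in\mathbb Z_{\ge 0}\}$. If $\lambda\in(\mathbb K\setminus\mathbb Z)\cup\mathcal A$, then the right adjoint $\omega_\lambda$ exists and $\Gamma_\lambda$ is an equivalence of categories. -/

import Mathlib

open CategoryTheory

universe u

namespace WeightedDMod

/-! ### The Weyl algebra and its grading -/

/-- Defining relations of the Weyl algebra in the letters `Sum.inl i` (for `x_i`) and
`Sum.inr i` (for `∂_i`). -/
inductive WeylRel (K : Type u) [Field K] (n : ℕ) :
    FreeAlgebra K (Fin (n + 1) ⊕ Fin (n + 1)) →
      FreeAlgebra K (Fin (n + 1) ⊕ Fin (n + 1)) → Prop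
  | x_comm (i j : Fin (n + 1)) : WeylRel K n
      (FreeAlgebra.ι K (Sum.inl i) * FreeAlgebra.ι K (Sum.inl j))
      (FreeAlgebra.ι K (Sum.inl j) * FreeAlgebra.ι K (Sum.inl i))
  | dd_comm (i j : Fin (n + 1)) : WeylRel K n
      (FreeAlgebra.ι K (Sum.inr i) * FreeAlgebra.ι K (Sum.inr j))
      (FreeAlgebra.ι K (Sum.inr j) * FreeAlgebra.ι K (Sum.inr i))
  | dd_x (i j : Fin (n + 1)) : WeylRel K n
      (FreeAlgebra.ι K (Sum.inr i) * FreeAlgebra.ι K (Sum.inl j))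
      (FreeAlgebra.ι K (Sum.inl j) * FreeAlgebra.ι K (Sum.inr i) + if i = j then 1 else 0)

/-- The Weyl algebra `K⟨x_0, …, x_n, ∂_0, …, ∂_n⟩`. -/
def Weyl (K : Type u) [Field K] (n : ℕ) : Type u := RingQuot (WeylRel K n)

noncomputable instance (K : Type u) [Field K] (n : ℕ) : Ring (Weyl K n) :=
  inferInstanceAs (Ring (RingQuot (WeylRel K n)))

noncomputable instance (K : Type u) [Field K] (n : ℕ) : Algebra K (Weyl K n) :=
  inferInstanceAs (Algebra K (RingQuot (WeylRel K n)))

/-- The quotient map from the free algebra to the Weyl algebra. -/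
noncomputable def Weyl.mk (K : Type u) [Field K] (n : ℕ) :
    FreeAlgebra K (Fin (n + 1) ⊕ Fin (n + 1)) →ₐ[K] Weyl K n :=
  RingQuot.mkAlgHom K (WeylRel K n)

theorem Weyl.mk_rel {K : Type u} [Field K] {n : ℕ}
    {a b : FreeAlgebra K (Fin (n + 1) ⊕ Fin (n + 1))} (h : WeylRel K n a b) :
    Weyl.mk K n a = Weyl.mk K n b :=
  RingQuot.mkAlgHom_rel K h

section Algebra

variable (K : Type u) [Field K] {n : ℕ}

/-- The generators of the Weyl algebra: `Sum.inl i ↦ x_i` and `Sum.inr i ↦ ∂_i`. -/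
noncomputable def gen (s : Fin (n + 1) ⊕ Fin (n + 1)) : Weyl K n :=
  Weyl.mk K n (FreeAlgebra.ι K s)

/-- The coordinate function `x_i`. -/
noncomputable def x (i : Fin (n + 1)) : Weyl K n := gen K (Sum.inl i)

/-- The partial derivative `∂_i`. -/
noncomputable def dd (i : Fin (n + 1)) : Weyl K n := gen K (Sum.inr i)

theorem x_mul_x (i j : Fin (n + 1)) : x K i * x K j = x K j * x K i := by
  simpa [x, gen] using Weyl.mk_rel (WeylRel.x_comm (K := K) i j)

theorem dd_mul_dd (i j : Fin (n + 1)) : dd K i * dd K j = dd K j * dd K i := by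
  simpa [dd, gen] using Weyl.mk_rel (WeylRel.dd_comm (K := K) i j)

theorem dd_mul_x (i j : Fin (n + 1)) :
    dd K i * x K j = x K j * dd K i + if i = j then 1 else 0 := by
  have h := Weyl.mk_rel (WeylRel.dd_x (K := K) i j)
  split_ifs at h ⊢ with hij <;> simpa [x, dd, gen, hij] using h

/-- The degrees of the generators: `deg x_i = d_i`, `deg ∂_i = -d_i`. -/
def genDeg (d : Fin (n + 1) → ℕ) : Fin (n + 1) ⊕ Fin (n + 1) → ℤ :=
  Sum.elim (fun i => (d i : ℤ)) (fun i => -(d i : ℤ))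

/-- The homogeneous component `D_k` of the Weyl algebra: the span of all words of degree `k`
in the generators. -/
noncomputable def weylPart (d : Fin (n + 1) → ℕ) (k : ℤ) : Submodule K (Weyl K n) :=
  Submodule.span K
    {w | ∃ l : List (Fin (n + 1) ⊕ Fin (n + 1)),
      (l.map (genDeg d)).sum = k ∧ (l.map (gen K)).prod = w}

/-- The homogeneous component `A_k` of the polynomial subalgebra `A = K[x_0, …, x_n]` of the
Weyl algebra: the span of all words of degree `k` in the `x_i`, where `deg x_i = d_i`. -/
noncomputable def polyPart (d : Fin (n + 1) → ℕ) (k : ℕ) : Submodule K (Weyl K n) :=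
  Submodule.span K
    {w | ∃ l : List (Fin (n + 1)), (l.map d).sum = k ∧ (l.map (x K)).prod = w}

instance weylPart_gradedMonoid (d : Fin (n + 1) → ℕ) :
    SetLike.GradedMonoid (weylPart K d) where
  one_mem := Submodule.subset_span ⟨[], by simp, by simp⟩
  mul_mem := by
    intro i j a b ha hb
    have h : a * b ∈ weylPart K d i * weylPart K d j := Submodule.mul_mem_mul ha hb
    rw [weylPart, weylPart, Submodule.span_mul_span] at h
    refine Submodule.span_mono ?_ h
    rintro _ ⟨_, ⟨l, rfl, rfl⟩, _, ⟨l', rfl, rfl⟩, rfl⟩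
    exact ⟨l ++ l', by simp, by simp⟩

/-- The subalgebra `D_0` of elements of degree zero. -/
noncomputable def degZero (d : Fin (n + 1) → ℕ) : Subalgebra K (Weyl K n) :=
  SetLike.GradeZero.subalgebra (weylPart K d)

theorem mem_degZero (d : Fin (n + 1) → ℕ) (a : Weyl K n) :
    a ∈ degZero K d ↔ a ∈ weylPart K d 0 := Iff.rfl

/-- The Euler field `E = ∑ d_i x_i ∂_i`. -/
noncomputable def euler (d : Fin (n + 1) → ℕ) : Weyl K n :=
  ∑ i, (d i : Weyl K n) * (x K i * dd K i)

theorem euler_mul_x (d : Fin (n + 1) → ℕ) (j : Fin (n + 1)) :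
    euler K d * x K j = x K j * euler K d + (d j : Weyl K n) * x K j := by
  have h : ∀ i, (d i : Weyl K n) * (x K i * dd K i) * x K j =
      x K j * ((d i : Weyl K n) * (x K i * dd K i)) +
        if i = j then (d j : Weyl K n) * x K j else 0 := by
    intro i
    have hc : x K j * (d i : Weyl K n) = (d i : Weyl K n) * x K j :=
      ((Nat.cast_commute (d i) (x K j)).eq).symm
    rw [mul_assoc, mul_assoc, dd_mul_x, ← mul_assoc (x K j), hc, mul_assoc, ← mul_assoc (x K j),
      x_mul_x K j i, mul_add, mul_add, mul_assoc]
    split_ifs with hij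
    · subst hij; simp
    · simp
  rw [euler, Finset.sum_mul, Finset.mul_sum, Finset.sum_congr rfl fun i _ => h i,
    Finset.sum_add_distrib]
  simp

theorem euler_mul_dd (d : Fin (n + 1) → ℕ) (j : Fin (n + 1)) :
    euler K d * dd K j = dd K j * euler K d - (d j : Weyl K n) * dd K j := by
  have h : ∀ i, (d i : Weyl K n) * (x K i * dd K i) * dd K j =
      dd K j * ((d i : Weyl K n) * (x K i * dd K i)) -
        if i = j then (d j : Weyl K n) * dd K j else 0 := by
    intro i
    have hc : dd K j * (d i : Weyl K n) = (d i : Weyl K n) * dd K j :=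
      ((Nat.cast_commute (d i) (dd K j)).eq).symm
    rw [mul_assoc, mul_assoc, dd_mul_dd K i j, ← mul_assoc (dd K j), hc, mul_assoc,
      ← mul_assoc (dd K j), dd_mul_x, add_mul, mul_add, mul_assoc]
    split_ifs with hij hji hji
    · subst hij; simp
    · exact absurd hij.symm hji
    · exact absurd hji.symm hij
    · simp
  rw [euler, Finset.sum_mul, Finset.mul_sum, Finset.sum_congr rfl fun i _ => h i,
    Finset.sum_sub_distrib]
  simp

theorem euler_mul_gen (d : Fin (n + 1) → ℕ) (s : Fin (n + 1) ⊕ Fin (n + 1)) :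
    euler K d * gen K s = gen K s * euler K d + (genDeg d s : Weyl K n) * gen K s := by
  rcases s with j | j
  · simpa [genDeg, x] using euler_mul_x K d j
  · simpa [genDeg, dd, sub_eq_add_neg, neg_mul] using euler_mul_dd K d j

theorem euler_mul_of_mem (d : Fin (n + 1) → ℕ) (k : ℤ) {a : Weyl K n}
    (ha : a ∈ weylPart K d k) :
    euler K d * a = a * euler K d + (k : Weyl K n) * a := by
  induction ha using Submodule.span_induction with
  | mem w hw =>
    obtain ⟨l, rfl, rfl⟩ := hw
    induction l with
    | nil => simp
    | cons s l ih =>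
      simp only [List.map_cons, List.prod_cons, List.sum_cons]
      have hc := (Int.cast_commute (l.map (genDeg d)).sum (gen K s)).eq
      rw [← mul_assoc, euler_mul_gen, add_mul, mul_assoc, ih, mul_add, ← mul_assoc (gen K s),
        ← mul_assoc (gen K s), ← hc]
      push_cast
      noncomm_ring
  | zero => simp
  | add a b _ _ ha hb => rw [mul_add, ha, hb]; noncomm_ring
  | smul c a _ ha => rw [mul_smul_comm, ha, smul_add, smul_mul_assoc, mul_smul_comm]

theorem euler_mem (d : Fin (n + 1) → ℕ) : euler K d ∈ degZero K d := by
  refine sum_mem fun i _ => mul_mem (natCast_mem _ _) ?_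
  exact Submodule.subset_span ⟨[Sum.inl i, Sum.inr i], by simp [genDeg], by simp [x, dd]⟩

/-- The Euler field as an element of `D_0`. -/
noncomputable def eulerZero (d : Fin (n + 1) → ℕ) : degZero K d := ⟨euler K d, euler_mem K d⟩

theorem eulerZero_comm (d : Fin (n + 1) → ℕ) (a : degZero K d) :
    eulerZero K d * a = a * eulerZero K d := by
  apply Subtype.ext
  simpa [eulerZero] using euler_mul_of_mem K d 0 a.2

end Algebra

section Twist

variable {K : Type u} [Field K] {n : ℕ} (d : Fin (n + 1) → ℕ) (lam : K)

/-- The element `E - λ` of `D_0`. -/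
noncomputable def eulerSub : degZero K d := eulerZero K d - algebraMap K _ lam

theorem eulerSub_comm (a : degZero K d) : eulerSub d lam * a = a * eulerSub d lam := by
  rw [eulerSub, sub_mul, mul_sub, eulerZero_comm, Algebra.commutes]

/-- The left ideal `D_0 (E - λ)`; it is two-sided since `E` is central in `D_0`. -/
noncomputable def twistIdeal : Ideal (degZero K d) := Ideal.span {eulerSub d lam}

instance twistIdeal_isTwoSided : (twistIdeal d lam).IsTwoSided where
  mul_mem_of_left {a} b ha := by
    obtain ⟨c, rfl⟩ := Ideal.mem_span_singleton'.1 ha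
    rw [mul_assoc, eulerSub_comm, ← mul_assoc]
    exact Ideal.mem_span_singleton'.2 ⟨_, rfl⟩

/-- The algebra `D_0 / D_0 (E - λ)` of global twisted differential operators. -/
abbrev TwistedOps : Type u := degZero K d ⧸ twistIdeal d lam

end Twist

/-! ### Weight spaces, Euler modules and torsion -/

section Modules

variable {K : Type u} [Field K] {n : ℕ} (d : Fin (n + 1) → ℕ)

/-- The `μ`-eigenspace `M^μ` of the Euler field on a `D`-module `M`, as a `D_0`-submodule. -/
noncomputable def weightSpace (M : Type u) [AddCommGroup M] [Module (Weyl K n) M] (μ : K) :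
    Submodule (degZero K d) M where
  carrier := {m | euler K d • m = algebraMap K (Weyl K n) μ • m}
  zero_mem' := by simp
  add_mem' {a b} ha hb := by
    simp only [Set.mem_ofPred_eq] at ha hb ⊢
    rw [smul_add, smul_add, ha, hb]
  smul_mem' c m hm := by
    simp only [Set.mem_ofPred_eq] at hm ⊢
    have h : euler K d * (c : Weyl K n) = c * euler K d :=
      congrArg Subtype.val (eulerZero_comm K d c)
    rw [Subalgebra.smul_def, ← mul_smul, h, mul_smul, hm, ← mul_smul, ← mul_smul,
      Algebra.commutes]

theorem mem_weightSpace {M : Type u} [AddCommGroup M] [Module (Weyl K n) M] {μ : K} {m : M} :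
    m ∈ weightSpace d M μ ↔ euler K d • m = algebraMap K (Weyl K n) μ • m := Iff.rfl

/-- `M` is `λ`-Euler: it is the sum of the eigenspaces `M^(λ + k)`, `k ∈ ℤ`.  (The sum is
automatically direct in characteristic zero; its `k`-th summand is the canonical degree `k`
part of `M`.) -/
def IsEuler (lam : K) (M : Type u) [AddCommGroup M] [Module (Weyl K n) M] : Prop :=
  ⨆ k : ℤ, weightSpace d M (lam + k) = ⊤

/-- `M` is torsion as a module over the graded ring `A = K[x_0, …, x_n]`: every element is
annihilated by `A_k` for all sufficiently large `k`. -/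
def IsTorsionModule (M : Type u) [AddCommGroup M] [Module (Weyl K n) M] : Prop :=
  ∀ m : M, ∃ N : ℕ, ∀ k > N, ∀ a ∈ polyPart K d k, a • m = 0

/-- On `M^λ` the ideal `D_0 (E - λ)` acts by zero. -/
theorem isTorsionBySet_weightSpace (M : Type u) [AddCommGroup M] [Module (Weyl K n) M] (lam : K) :
    Module.IsTorsionBySet (degZero K d) (weightSpace d M lam) (twistIdeal d lam) := by
  rintro ⟨m, hm⟩ ⟨a, ha⟩
  obtain ⟨c, rfl⟩ := Ideal.mem_span_singleton'.1 ha
  apply Subtype.ext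
  change ((c * eulerSub d lam : degZero K d) : Weyl K n) • m = 0
  have h : ((eulerSub d lam : degZero K d) : Weyl K n) • m = 0 := by
    change (euler K d - algebraMap K (Weyl K n) lam) • m = 0
    rw [sub_smul, (mem_weightSpace d).1 hm, sub_self]
  rw [Subalgebra.coe_mul, mul_smul, h, smul_zero]

/-- The `D_0 / D_0 (E - λ)`-module structure on `M^λ` induced by the action of `D_0`. -/
noncomputable instance weightSpaceModule (M : Type u) [AddCommGroup M] [Module (Weyl K n) M]
    (lam : K) : Module (TwistedOps d lam) (weightSpace d M lam) :=
  (isTorsionBySet_weightSpace d M lam).module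

theorem mk_smul_weightSpace (M : Type u) [AddCommGroup M] [Module (Weyl K n) M] (lam : K)
    (a : degZero K d) (m : weightSpace d M lam) :
    (Ideal.Quotient.mk (twistIdeal d lam) a) • m = a • m := rfl

/-- The map `M^λ → N^λ` induced by a homomorphism `M → N` of `D`-modules. -/
noncomputable def weightMap (lam : K) {M N : Type u} [AddCommGroup M] [Module (Weyl K n) M] [AddCommGroup N]
    [Module (Weyl K n) N] (f : M →ₗ[Weyl K n] N) :
    weightSpace d M lam →ₗ[TwistedOps d lam] weightSpace d N lam where
  toFun m := ⟨f m, by rw [mem_weightSpace, ← map_smul, (mem_weightSpace d).1 m.2, map_smul]⟩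
  map_add' a b := by ext; simp
  map_smul' a m := by
    obtain ⟨a, rfl⟩ := Ideal.Quotient.mk_surjective a
    apply Subtype.ext
    change f ((a : Weyl K n) • (m : M)) = (a : Weyl K n) • f m
    exact map_smul f _ _

end Modules

/-! ### The categories and the functors -/

section Categories

variable {K : Type u} [Field K] {n : ℕ} (d : Fin (n + 1) → ℕ) (lam : K)

/-- The category of `λ`-Euler `D`-modules.  A `D`-linear map preserves the eigenspaces of the
Euler field, so this is a full subcategory both of all `D`-modules and, through the canonical
grading, of all graded `D`-modules. -/
abbrev EulerMod : Type (u + 1) :=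
  ObjectProperty.FullSubcategory (C := ModuleCat.{u} (Weyl K n)) (fun M => IsEuler d lam M)

/-- The homomorphisms of `λ`-Euler modules whose kernel and cokernel are torsion. -/
def isoModTorsion : MorphismProperty (EulerMod d lam) := fun _ N f =>
  IsTorsionModule (K := K) d (LinearMap.ker f.hom.hom) ∧
    IsTorsionModule (K := K) d (N.obj ⧸ LinearMap.range f.hom.hom)

/-- The category of `λ`-twisted D-modules on the weighted projective stack: the Serre quotient
of the category of `λ`-Euler `D`-modules by its full subcategory of torsion modules, i.e. its
localization at the homomorphisms with torsion kernel and cokernel. -/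
abbrev TwistedDMod : Type (u + 1) := (isoModTorsion d lam).Localization

/-- The quotient functor `π_λ`. -/
noncomputable abbrev quotientFunctor : EulerMod d lam ⥤ TwistedDMod d lam := (isoModTorsion d lam).Q

/-- The functor `M ↦ M_0 = M^λ` taking a `λ`-Euler module to its part of degree zero. -/
noncomputable def degZeroFunctor : EulerMod d lam ⥤ ModuleCat.{u} (TwistedOps d lam) where
  obj M := ModuleCat.of _ (weightSpace d M.obj lam)
  map f := ModuleCat.ofHom (weightMap d lam f.hom.hom)

/-- The global sections functor `Γ_λ(𝓜) = ω(𝓜)_0`, where `ω` is the section functor, i.e. a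
right adjoint of the quotient functor. -/
noncomputable def globalSections (ω : TwistedDMod d lam ⥤ EulerMod d lam)
    (_ : quotientFunctor d lam ⊣ ω) :
    TwistedDMod d lam ⥤ ModuleCat.{u} (TwistedOps d lam) :=
  ω ⋙ degZeroFunctor d lam

/-- The semigroup `𝒜`, i.e. the `ℤ_{≥ 0}`-span of the weights, inside `K`. -/
def weightSemigroup (K : Type u) [Field K] {n : ℕ} (d : Fin (n + 1) → ℕ) : AddSubmonoid K :=
  AddSubmonoid.closure (Set.range fun i => (d i : K))

end Categories

end WeightedDMod

/-! The heart is that, for these `lam`, a `λ`-Euler module `M` is torsion exactly when `M^λ = 0`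
(`isTorsionModule_iff`).

If `M` is torsion, the `x_i` act nilpotently on any nonzero `m ∈ M^λ`, so some word in the `x_i`
sends `m` to a nonzero vector killed by every `x_i`. Such a vector has weight `-∑ d_i`, which makes
`λ` a negative integer, and this is excluded.

Conversely, let `M^λ = 0`. If `k ≥ 0` is divisible by all the weights and `0 ≠ m ∈ M^(λ+k)`, the
`∂_i` are nilpotent on `m`, and some word in them yields a nonzero vector killed by every `∂_i`, of
weight `0`. Then `λ` is an integer, hence lies in the semigroup, and a monomial of degree `λ`
carries this vector to a nonzero element of `M^λ`, a contradiction. An `x_j`, `∂_j` argument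
together with `gcd = 1` spreads the vanishing to all large `k`, and `M` is torsion.

Since `M ↦ M^λ` is exact, it inverts exactly the maps with torsion kernel and cokernel
(`isoModTorsion_eq`). It has a right adjoint, the Euler part of `Hom_{D_0}(D, N)`, whose counit is
invertible (`eulerCoindEval_bijective`). So it is itself a localization at these maps, and
uniqueness of localizations identifies its target with the Serre quotient. -/

namespace WeightedDMod

/-! ### Weyl algebra computations on vectors of a module -/

section Action

variable {K : Type u} [Field K] {n : ℕ} {M : Type u} [AddCommGroup M] [Module (Weyl K n) M]

theorem algebraMap_smul_eq_zero {c : K} (hc : c ≠ 0) {m : M}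
    (h : algebraMap K (Weyl K n) c • m = 0) : m = 0 := by
  have h1 := congrArg (fun y => algebraMap K (Weyl K n) c⁻¹ • y) h
  simpa [← mul_smul, ← map_mul, inv_mul_cancel₀ hc] using h1

theorem natCast_smul_eq_zero [CharZero K] {c : ℕ} (hc : c ≠ 0) {m : M}
    (h : (c : Weyl K n) • m = 0) : m = 0 :=
  algebraMap_smul_eq_zero (K := K) (n := n) (c := (c : K)) (by exact_mod_cast hc)
    (by simpa using h)

theorem smul_mem_weightSpace (d : Fin (n + 1) → ℕ) {k : ℤ} {a : Weyl K n}
    (ha : a ∈ weylPart K d k) {μ : K} {m : M} (hm : m ∈ weightSpace d M μ) :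
    a • m ∈ weightSpace d M (μ + k) := by
  rw [mem_weightSpace] at hm ⊢
  rw [← mul_smul, euler_mul_of_mem K d k ha, add_smul, mul_smul, hm, mul_smul, ← mul_smul,
    ← Algebra.commutes, mul_smul, map_add, add_smul, map_intCast]

theorem x_prod_mem (d : Fin (n + 1) → ℕ) (l : List (Fin (n + 1))) :
    (l.map (x K)).prod ∈ weylPart K d ((l.map d).sum : ℕ) := by
  refine Submodule.subset_span ⟨l.map Sum.inl, ?_, by rw [List.map_map]; rfl⟩
  induction l <;> simp_all [genDeg]

theorem dd_prod_mem (d : Fin (n + 1) → ℕ) (l : List (Fin (n + 1))) :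
    (l.map (dd K)).prod ∈ weylPart K d (-((l.map d).sum : ℕ)) := by
  refine Submodule.subset_span ⟨l.map Sum.inr, ?_, by rw [List.map_map]; rfl⟩
  induction l <;> simp_all [genDeg, add_comm]

theorem x_mem (d : Fin (n + 1) → ℕ) (i : Fin (n + 1)) : x K i ∈ weylPart K d (d i) := by
  simpa using x_prod_mem (K := K) d [i]

theorem dd_pow_mem (d : Fin (n + 1) → ℕ) (i : Fin (n + 1)) (b : ℕ) :
    dd K i ^ b ∈ weylPart K d (-((b * d i : ℕ) : ℤ)) := by
  simpa using dd_prod_mem (K := K) d (List.replicate b i)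

theorem polyPart_le_weylPart (d : Fin (n + 1) → ℕ) (k : ℕ) :
    polyPart K d k ≤ weylPart K d k := by
  refine Submodule.span_le.2 ?_
  rintro _ ⟨l, rfl, rfl⟩
  exact x_prod_mem d l

/-- Commuting locally nilpotent operators have a common kernel vector among the words applied to
a nonzero vector. -/
theorem exists_word_killed {R ι : Type*} [Ring R] [Finite ι] {V : Type*} [AddCommGroup V]
    [Module R V] (g : ι → R) (hg : ∀ i j, g i * g j = g j * g i) {m : V} (hm : m ≠ 0)
    (hnil : ∀ i, ∃ N, g i ^ N • m = 0) :
    ∃ l : List ι, (l.map g).prod • m ≠ 0 ∧ ∀ i, g i • (l.map g).prod • m = 0 := by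
  classical
  have := Fintype.ofFinite ι
  suffices H : ∀ s : Finset ι, ∃ l : List ι, (l.map g).prod • m ≠ 0 ∧
      ∀ i ∈ s, g i • (l.map g).prod • m = 0 by
    obtain ⟨l, h1, h2⟩ := H Finset.univ
    exact ⟨l, h1, fun i => h2 i (Finset.mem_univ i)⟩
  intro s
  induction s using Finset.induction_on with
  | empty => exact ⟨[], by simpa using hm, by simp⟩
  | insert i s _ ih =>
    obtain ⟨l, h1, h2⟩ := ih
    have hcomm : ∀ l : List ι, ∀ j, Commute (g j) (l.map g).prod := fun l j =>
      Commute.list_prod_right _ _ fun y hy => by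
        obtain ⟨k, -, rfl⟩ := List.mem_map.1 hy
        exact hg j k
    have hex : ∃ N, g i ^ N • (l.map g).prod • m = 0 := by
      obtain ⟨N, hN⟩ := hnil i
      refine ⟨N, ?_⟩
      rw [← mul_smul, ((hcomm l i).pow_left N).eq, mul_smul, hN, smul_zero]
    -- With `c + 1` the least exponent that kills the vector, `g i ^ c` leaves it nonzero and killed
    -- by `g i`; commutation preserves the earlier vanishing.
    have hpos : Nat.find hex ≠ 0 := fun h0 => h1 (by simpa [h0] using Nat.find_spec hex)
    obtain ⟨c, hc⟩ := Nat.exists_eq_succ_of_ne_zero hpos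
    have hw : ((List.replicate c i ++ l).map g).prod • m = g i ^ c • (l.map g).prod • m := by
      simp [mul_smul]
    refine ⟨List.replicate c i ++ l, ?_, ?_⟩
    · rw [hw]
      exact Nat.find_min hex (by omega)
    · intro j hj
      rw [hw]
      rcases Finset.mem_insert.1 hj with rfl | hj
      · rw [← mul_smul, ← pow_succ', ← Nat.succ_eq_add_one, ← hc]
        exact Nat.find_spec hex
      · have hji : Commute (g j) (g i ^ c) := Commute.pow_right (hg j i) c
        rw [← mul_smul, hji.eq, mul_smul, h2 j hj, smul_zero]

/-- Each `x_i ∂_i = ∂_i x_i - 1` acts as `-1` on such a vector, which behaves like a delta function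
at the origin. -/
theorem euler_smul_of_x_smul_eq_zero (d : Fin (n + 1) → ℕ) {m : M}
    (h : ∀ i : Fin (n + 1), x K i • m = 0) :
    euler K d • m = algebraMap K (Weyl K n) (-((∑ i, d i : ℕ) : K)) • m := by
  have hi : ∀ i : Fin (n + 1), (x K i * dd K i) • m = -m := by
    intro i
    have h1 : x K i * dd K i = dd K i * x K i - 1 := by rw [dd_mul_x]; simp
    rw [h1, sub_smul, mul_smul, h i]; simp
  simp only [euler, Finset.sum_smul, mul_smul _ (x K _ * dd K _), hi]
  simp [Finset.sum_smul]

theorem euler_smul_of_dd_smul_eq_zero (d : Fin (n + 1) → ℕ) {m : M}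
    (h : ∀ i : Fin (n + 1), dd K i • m = 0) :
    euler K d • m = 0 := by
  simp [euler, Finset.sum_smul, mul_smul, h]

/-- A vector killed by `∂_i` behaves like a constant in `x_i`, so `x_i ∂_i` measures the degree of a
monomial in `x_i`. -/
theorem x_mul_dd_smul_word (i : Fin (n + 1)) {m : M} (h : dd K i • m = 0)
    (l : List (Fin (n + 1))) :
    (x K i * dd K i) • (l.map (x K)).prod • m =
      ((l.count i : ℕ) : Weyl K n) • (l.map (x K)).prod • m := by
  induction l with
  | nil => simp [mul_smul, h]
  | cons j l ih =>
    set w := (l.map (x K)).prod • m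
    have h1 : x K i * dd K i * x K j = x K j * (x K i * dd K i) + if i = j then x K i else 0 := by
      rw [mul_assoc, dd_mul_x, mul_add, ← mul_assoc, x_mul_x K i j, mul_assoc]
      split_ifs <;> simp
    rw [List.map_cons, List.prod_cons, mul_smul (x K j), ← mul_smul _ (x K j), h1, add_smul,
      mul_smul, ih, ← mul_smul (x K j), ← (Nat.cast_commute _ (x K j)).eq, mul_smul]
    split_ifs with hij
    · subst hij
      simp [add_smul, w]
    · simp [Ne.symm hij, w]

/-- Applying `∂_i` to `x_i w` returns `w` times the positive integer `l.count i + 1`, so in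
characteristic zero no letter can kill. -/
theorem word_smul_ne_zero [CharZero K] {m : M} (hm : m ≠ 0) (h : ∀ i : Fin (n + 1), dd K i • m = 0)
    (l : List (Fin (n + 1))) : (l.map (x K)).prod • m ≠ 0 := by
  induction l with
  | nil => simpa using hm
  | cons i l ih =>
    intro h0
    apply ih
    rw [List.map_cons, List.prod_cons, mul_smul] at h0
    have h1 : dd K i • x K i • (l.map (x K)).prod • m = 0 := by rw [h0, smul_zero]
    rw [← mul_smul, dd_mul_x, if_pos rfl, add_smul, one_smul, x_mul_dd_smul_word i (h i)] at h1
    refine natCast_smul_eq_zero (K := K) (n := n) (Nat.succ_ne_zero (l.count i)) ?_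
    rw [Nat.succ_eq_add_one, Nat.cast_add, Nat.cast_one, add_smul, one_smul, h1]

theorem x_mul_dd_pow_smul (i : Fin (n + 1)) {m : M} (h : x K i • m = 0) (b : ℕ) :
    x K i • dd K i ^ (b + 1) • m = -(((b + 1 : ℕ) : Weyl K n) • dd K i ^ b • m) := by
  have h1 : x K i * dd K i = dd K i * x K i - 1 := by rw [dd_mul_x]; simp
  induction b with
  | zero => rw [zero_add, pow_one, ← mul_smul, h1, sub_smul, mul_smul, h]; simp
  | succ b ih =>
    rw [pow_succ' _ (b + 1), mul_smul, ← mul_smul, h1, sub_smul, mul_smul, ih, smul_neg,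
      ← mul_smul, ← (Nat.cast_commute _ (dd K i)).eq, mul_smul, ← mul_smul (dd K i), ← pow_succ']
    push_cast
    simp only [add_smul, one_smul]
    abel

/-- Applying `x_i` to `∂_i ^ (b + 1) m = 0` lowers the exponent, at the cost of the invertible
factor `-(b + 1)`. -/
theorem eq_zero_of_x_smul_of_dd_pow_smul [CharZero K] (i : Fin (n + 1)) {m : M}
    (h : x K i • m = 0) (b : ℕ) (hb : dd K i ^ b • m = 0) : m = 0 := by
  induction b with
  | zero => simpa using hb
  | succ b ih =>
    apply ih
    have h1 := x_mul_dd_pow_smul i h b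
    rw [hb, smul_zero, eq_comm, neg_eq_zero] at h1
    exact natCast_smul_eq_zero (K := K) (n := n) (Nat.succ_ne_zero b) h1

theorem eq_of_mem_weightSpace (d : Fin (n + 1) → ℕ) {μ ν : K} {m : M} (hm : m ≠ 0)
    (h1 : m ∈ weightSpace d M μ) (h2 : m ∈ weightSpace d M ν) : μ = ν := by
  rw [mem_weightSpace] at h1 h2
  by_contra hne
  refine hm (algebraMap_smul_eq_zero (K := K) (n := n) (sub_ne_zero.2 hne) ?_)
  rw [map_sub, sub_smul, ← h1, ← h2, sub_self]

end Action

/-! ### The semigroup of weights and the gcd condition -/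

section Semigroup

variable {K : Type u} [Field K] {n : ℕ} (d : Fin (n + 1) → ℕ)

theorem exists_list_of_mem_weightSemigroup {a : K} (h : a ∈ weightSemigroup K d) :
    ∃ l : List (Fin (n + 1)), a = ((l.map d).sum : ℕ) := by
  induction h using AddSubmonoid.closure_induction with
  | mem _ h => obtain ⟨i, rfl⟩ := h; exact ⟨[i], by simp⟩
  | zero => exact ⟨[], by simp⟩
  | add _ _ _ _ h1 h2 =>
    obtain ⟨l, rfl⟩ := h1
    obtain ⟨l', rfl⟩ := h2
    exact ⟨l ++ l', by simp⟩

theorem addSubgroup_eq_top_of_gcd (hgcd : Finset.univ.gcd d = 1) (H : AddSubgroup ℤ)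
    (h : ∀ i, (d i : ℤ) ∈ H) : H = ⊤ := by
  obtain ⟨g, rfl⟩ := Int.subgroup_cyclic H
  have h1 : g.natAbs ∣ 1 := by
    rw [← hgcd]
    refine Finset.dvd_gcd fun i _ => ?_
    obtain ⟨c, hc⟩ := AddSubgroup.mem_closure_singleton.1 (h i)
    rw [← Int.natCast_dvd_natCast, Int.natAbs_dvd]
    exact ⟨c, by rw [← hc, smul_eq_mul, mul_comm]⟩
  have h2 : g.natAbs = 1 := Nat.dvd_one.1 h1
  rw [eq_top_iff]
  rintro z -
  rw [AddSubgroup.mem_closure_singleton]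
  rcases Int.natAbs_eq g with h3 | h3
  · exact ⟨z, by rw [h3, h2]; simp⟩
  · exact ⟨-z, by rw [h3, h2]; simp⟩

end Semigroup

/-! ### Torsion modules and the vanishing of `M^λ` -/

section Torsion

variable {K : Type u} [Field K] [CharZero K] {n : ℕ} (d : Fin (n + 1) → ℕ) {lam : K}
  {M : Type u} [AddCommGroup M] [Module (Weyl K n) M]

theorem weightSpace_eq_bot_of_isTorsionModule
    (hd : ∀ i, 0 < d i)
    (hlam : lam ∉ Set.range (Int.cast : ℤ → K) ∨ lam ∈ weightSemigroup K d)
    (h : IsTorsionModule (K := K) d M) :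
    weightSpace d M lam = ⊥ := by
  rw [eq_bot_iff]
  intro m hm
  by_contra hm0
  change m ≠ 0 at hm0
  obtain ⟨N, hN⟩ := h m
  -- `x_i ^ (N + 1)` has degree `(N + 1) d_i > N`, beyond the torsion bound of `m`.
  obtain ⟨l, h1, h2⟩ := exists_word_killed (x K) (x_mul_x K) hm0 fun i => ⟨N + 1, hN
    ((N + 1) * d i) (by nlinarith [hd i]) _ (Submodule.subset_span
      ⟨List.replicate (N + 1) i, by simp, by simp⟩)⟩
  have h3 := smul_mem_weightSpace d (x_prod_mem (K := K) d l) hm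
  have h4 := eq_of_mem_weightSpace d h1 h3 (euler_smul_of_x_smul_eq_zero d h2)
  -- Comparing the two weights of the killed vector puts `λ` strictly below zero among the integers.
  have h5 : lam = ((-((l.map d).sum + ∑ i, d i : ℕ) : ℤ) : K) := by
    push_cast at h4 ⊢
    linear_combination h4
  rcases hlam with hl | hl
  · exact hl ⟨_, h5.symm⟩
  · obtain ⟨l', rfl⟩ := exists_list_of_mem_weightSemigroup d hl
    have h6 : (((l'.map d).sum : ℤ) : K) = ((-((l.map d).sum + ∑ i, d i : ℕ) : ℤ) : K) := by
      rw [← h5, Int.cast_natCast]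
    have h7 := Int.cast_injective h6
    have h8 : 0 < ∑ i, d i := Finset.sum_pos (fun i _ => hd i) ⟨0, Finset.mem_univ _⟩
    omega

/-- If `M^λ = 0` then `M^(λ + k) = 0` for all `k ≥ 0` divisible by all the weights. -/
theorem weightSpace_add_eq_bot_of_dvd
    (hlam : lam ∉ Set.range (Int.cast : ℤ → K) ∨ lam ∈ weightSemigroup K d)
    (h : weightSpace d M lam = ⊥) (k : ℕ)
    (hk : ∀ i, d i ∣ k) : weightSpace d M (lam + k) = ⊥ := by
  rw [eq_bot_iff]
  intro m hm
  by_contra hm0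
  change m ≠ 0 at hm0
  -- Divisibility makes this power have degree exactly `-k`, so it lands in `M^λ = 0`.
  have hnil : ∀ i, dd K i ^ (k / d i) • m = 0 := by
    intro i
    have h1 := smul_mem_weightSpace d (dd_pow_mem (K := K) d i (k / d i)) hm
    rw [Nat.div_mul_cancel (hk i)] at h1
    simpa [h] using h1
  obtain ⟨l, h1, h2⟩ := exists_word_killed (dd K) (dd_mul_dd K) hm0 fun i => ⟨_, hnil i⟩
  set v := (l.map (dd K)).prod • m
  have h0 : v ∈ weightSpace d M (0 : K) := by
    rw [mem_weightSpace, euler_smul_of_dd_smul_eq_zero d h2]; simp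
  have h3 := eq_of_mem_weightSpace d h1 (smul_mem_weightSpace d (dd_prod_mem (K := K) d l) hm) h0
  rcases hlam with hl | hl
  · exact hl ⟨(l.map d).sum - k, by push_cast at h3 ⊢; linear_combination -h3⟩
  -- The word `l'` has degree `λ`, so it moves `v` from weight `0` into `M^λ`.
  · obtain ⟨l', rfl⟩ := exists_list_of_mem_weightSemigroup d hl
    have h4 := smul_mem_weightSpace d (x_prod_mem (K := K) d l') h0
    refine word_smul_ne_zero h1 h2 l' ?_
    rw [zero_add, Int.cast_natCast, h] at h4
    exact h4

/-- Vanishing far out along the multiples of a common multiple `L` of the weights spreads to every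
residue class mod `L`, because the classes where it holds are stable under translation by each `d_j`
and `gcd = 1`. Finitely many classes then give a uniform bound. -/
theorem exists_weightSpace_add_eq_bot
    (hd : ∀ i, 0 < d i)
    (hlam : lam ∉ Set.range (Int.cast : ℤ → K) ∨ lam ∈ weightSemigroup K d)
    (hgcd : Finset.univ.gcd d = 1)
    (h : weightSpace d M lam = ⊥) :
    ∃ B : ℤ, ∀ k ≥ B, weightSpace d M (lam + k) = ⊥ := by
  set L : ℕ := ∏ i, d i with hL
  have hdL : ∀ i, d i ∣ L := fun i => Finset.dvd_prod_of_mem d (Finset.mem_univ i)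
  have hLpos : 0 < L := Finset.prod_pos fun i _ => hd i
  -- `T` collects the `k` whose class mod `L` has eventually vanishing weight spaces.
  let T : Set ℤ := {k | ∃ R : ℤ, ∀ r ≥ R, weightSpace d M (lam + (k + r * L : ℤ)) = ⊥}
  have h0 : (0 : ℤ) ∈ T := by
    refine ⟨0, fun r hr => ?_⟩
    lift r to ℕ using hr
    have := weightSpace_add_eq_bot_of_dvd d hlam h (r * L) fun i => (hdL i).mul_left r
    simpa using this
  have hsub : ∀ k ∈ T, ∀ j, k - d j ∈ T := by
    rintro k ⟨R, hR⟩ j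
    refine ⟨R + 1, fun r hr => ?_⟩
    rw [eq_bot_iff]
    intro m hm
    -- With `L = d_j q`, both `x_j` (up by `d_j`) and `∂_j ^ (q - 1)` (down by `L - d_j`) send `m`
    -- into the class of `k`, at heights `r` and `r - 1`. Both images vanish, which forces `m = 0`;
    -- the height `r - 1` is why the threshold is `R + 1`.
    obtain ⟨q, hq⟩ := hdL j
    have hq0 : 0 < q := Nat.pos_of_ne_zero (by rintro rfl; simp at hq; omega)
    have h1 := smul_mem_weightSpace d (x_mem (K := K) d j) hm
    have h2 := smul_mem_weightSpace d (dd_pow_mem (K := K) d j (q - 1)) hm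
    have e1 : lam + ((k - d j + r * L : ℤ) : K) + ((d j : ℤ) : K)
        = lam + ((k + r * L : ℤ) : K) := by push_cast; ring
    have e2 : lam + ((k - d j + r * L : ℤ) : K) + ((-(((q - 1) * d j : ℕ) : ℤ) : ℤ) : K)
        = lam + ((k + (r - 1) * L : ℤ) : K) := by
      rw [hq]
      push_cast [Nat.cast_sub (show 1 ≤ q from hq0)]
      ring
    rw [e1, hR r (by omega)] at h1
    rw [e2, hR (r - 1) (by omega)] at h2
    exact eq_zero_of_x_smul_of_dd_pow_smul j h1 _ h2
  have hper : ∀ k, ∀ c : ℤ, k + c * L ∈ T ↔ k ∈ T := by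
    intro k c
    constructor
    · rintro ⟨R, hR⟩
      refine ⟨R + c, fun r hr => ?_⟩
      have := hR (r - c) (by omega)
      rwa [show k + c * L + (r - c) * L = k + r * L by ring] at this
    · rintro ⟨R, hR⟩
      refine ⟨R - c, fun r hr => ?_⟩
      have := hR (r + c) (by omega)
      rwa [show k + (r + c) * L = k + c * L + r * L by ring] at this
  have hsubs : ∀ j, ∀ b : ℕ, ∀ k ∈ T, k - b * d j ∈ T := by
    intro j b
    induction b with
    | zero => intro k hk; simpa using hk
    | succ b ih =>
      intro k hk
      have := hsub _ (ih k hk) j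
      rwa [show k - b * d j - (d j : ℤ) = k - (b + 1 : ℕ) * d j by push_cast; ring] at this
  -- The stabilizer of `T` under translation is a subgroup, so it suffices that it contains every
  -- `d_j`.
  let H : AddSubgroup ℤ :=
    { carrier := {z | ∀ k, k + z ∈ T ↔ k ∈ T}
      zero_mem' := by simp
      add_mem' := by
        intro a b ha hb k
        rw [← add_assoc, hb, ha]
      neg_mem' := by
        intro a ha k
        rw [← ha (k + -a)]
        simp }
  have hH : H = ⊤ := by
    refine addSubgroup_eq_top_of_gcd d hgcd H fun j k => ⟨fun hk => ?_, fun hk => ?_⟩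
    · simpa using hsub _ hk j
    · obtain ⟨q, hq⟩ := hdL j
      have hq0 : 0 < q := Nat.pos_of_ne_zero (by rintro rfl; simp at hq; omega)
      -- Adding `d_j` is the same, modulo the period `L`, as subtracting it `q - 1` times.
      have h1 := hsubs j (q - 1) _ ((hper k 1).2 hk)
      have e : k + 1 * (L : ℤ) - ((q - 1 : ℕ) : ℤ) * d j = k + d j := by
        rw [hq]
        push_cast [Nat.cast_sub (show 1 ≤ q from hq0)]
        ring
      rwa [e] at h1
  have hT : ∀ k, k ∈ T := by
    intro k
    have hk : k ∈ H := hH ▸ AddSubgroup.mem_top k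
    simpa using (hk 0).2 h0
  choose R hR using hT
  -- `B` bounds the thresholds of the residues `0, …, L - 1`; for `k ≥ (|B| + 1) L` the quotient `k
  -- / L` exceeds all of them.
  obtain ⟨B, hB⟩ := ((Finset.range L).image fun k : ℕ => R k).bddAbove
  refine ⟨(|B| + 1) * L, fun k hk => ?_⟩
  have hL' : (0 : ℤ) < L := by exact_mod_cast hLpos
  have h1 := Int.emod_nonneg k hL'.ne'
  have h2 := Int.emod_lt_of_pos k hL'
  have h3 := Int.emod_add_mul_ediv k L
  obtain ⟨s, hs⟩ := Int.eq_ofNat_of_zero_le h1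
  have h4 : R s ≤ B := hB (by
    simp only [Finset.coe_image, Finset.coe_range]
    exact ⟨s, by simp only [Set.mem_Iio]; omega, rfl⟩)
  have h5 : |B| + 1 ≤ k / L := (Int.le_ediv_iff_mul_le hL').2 hk
  have := hR s (k / L) (by linarith [le_abs_self B])
  rwa [← hs, mul_comm, h3] at this

/-- Polynomials of large degree push a weight vector past the bound where the weight spaces vanish,
and every element is a finite sum of weight vectors. -/
theorem isTorsionModule_of_weightSpace_eq_bot
    (hd : ∀ i, 0 < d i)
    (hlam : lam ∉ Set.range (Int.cast : ℤ → K) ∨ lam ∈ weightSemigroup K d)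
    (hgcd : Finset.univ.gcd d = 1)
    (hM : IsEuler d lam M) (h : weightSpace d M lam = ⊥) : IsTorsionModule (K := K) d M := by
  obtain ⟨B, hB⟩ := exists_weightSpace_add_eq_bot d hd hlam hgcd h
  intro m
  have hm : m ∈ ⨆ k : ℤ, weightSpace d M (lam + k) := by rw [hM]; trivial
  induction hm using Submodule.iSup_induction' with
  | mem k m hm =>
    refine ⟨(B - k).toNat, fun j hj a ha => ?_⟩
    have h1 := smul_mem_weightSpace d (polyPart_le_weylPart d j ha) hm
    have e : lam + (k : K) + ((j : ℤ) : K) = lam + ((k + j : ℤ) : K) := by push_cast; ring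
    rw [e, hB _ (by omega)] at h1
    exact h1
  | zero => exact ⟨0, fun k _ a _ => smul_zero a⟩
  | add a b _ _ h1 h2 =>
    obtain ⟨N1, h1⟩ := h1
    obtain ⟨N2, h2⟩ := h2
    refine ⟨max N1 N2, fun k hk c hc => ?_⟩
    rw [smul_add, h1 k (by omega) c hc, h2 k (by omega) c hc, add_zero]

end Torsion

/-! ### Weight decompositions and projections -/

/-- Families of submodules contained in the eigenspaces of a linear operator for distinct
eigenvalues are independent, over whatever ring they are submodules. -/
theorem iSupIndep_of_eigen {K R V ι : Type*} [Field K] [Ring R] [AddCommGroup V] [Module K V]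
    [Module R V] (T : Module.End K V) {μ : ι → K} (hμ : Function.Injective μ)
    (W : ι → Submodule R V) (h : ∀ i, ∀ v ∈ W i, T v = μ i • v) : iSupIndep W := by
  intro i
  rw [Submodule.disjoint_def]
  intro v hv hv'
  rw [iSup_subtype' (p := fun j => j ≠ i) (f := fun j _ => W j)] at hv'
  have h1 : v ∈ ⨆ ν, ⨆ (_ : ν ≠ μ i), T.eigenspace ν := by
    clear hv
    induction hv' using Submodule.iSup_induction' with
    | mem j v hv =>
      refine Submodule.mem_iSup_of_mem (μ j.1) (Submodule.mem_iSup_of_mem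
        (fun he => j.2 (hμ he)) ?_)
      exact Module.End.mem_eigenspace_iff.2 (h _ v hv)
    | zero => exact zero_mem _
    | add a b _ _ ha hb => exact add_mem ha hb
  exact Submodule.disjoint_def.1 (T.eigenspaces_iSupIndep (μ i)) v
    (Module.End.mem_eigenspace_iff.2 (h _ v hv)) h1

theorem exists_proj_of_iSupIndep {R V ι : Type*} [Ring R] [AddCommGroup V] [Module R V]
    {W : ι → Submodule R V} (hW : iSupIndep W) (htop : ⨆ i, W i = ⊤) (i : ι) :
    ∃ p : V →ₗ[R] W i, (∀ v : W i, p v = v) ∧ ∀ j, j ≠ i → ∀ v ∈ W j, p v = 0 := by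
  have hc : IsCompl (W i) (⨆ (j) (_ : j ≠ i), W j) := by
    refine ⟨hW i, codisjoint_iff_le_sup.2 ?_⟩
    rw [← htop]
    refine iSup_le fun j => ?_
    by_cases hj : j = i
    · subst hj
      exact le_sup_left
    · exact le_sup_of_le_right (le_iSup₂_of_le j hj le_rfl)
  refine ⟨Submodule.projectionOnto _ _ hc, Submodule.projectionOnto_apply_left hc,
    fun j hj v hv => ?_⟩
  exact (Submodule.projectionOnto_apply_eq_zero_iff hc).2
    ((le_iSup₂_of_le (f := fun j (_ : j ≠ i) => W j) j hj le_rfl) hv)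

section Projection

variable {K : Type u} [Field K] {n : ℕ} (d : Fin (n + 1) → ℕ) (lam : K)
  {M : Type u} [AddCommGroup M] [Module (Weyl K n) M]

theorem weightSpace_iSupIndep [CharZero K] (M : Type u) [AddCommGroup M] [Module (Weyl K n) M] :
    iSupIndep fun k : ℤ => weightSpace d M (lam + k) := by
  let _ : Module K M := Module.compHom M (algebraMap K (Weyl K n))
  refine iSupIndep_of_eigen (K := K)
    { toFun := fun m => euler K d • m
      map_add' := smul_add _
      map_smul' := fun c m => ?_ } (μ := fun k : ℤ => lam + k) ?_ _ fun k m hm => hm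
  · change euler K d • algebraMap K (Weyl K n) c • m = algebraMap K (Weyl K n) c • euler K d • m
    rw [← mul_smul, ← Algebra.commutes, mul_smul]
  · intro a b h
    simpa using h

variable {d lam}

theorem exists_weightProj [CharZero K] (hM : IsEuler d lam M) :
    ∃ p : M →ₗ[degZero K d] weightSpace d M lam, (∀ m : weightSpace d M lam, p m = m) ∧
      ∀ k : ℤ, k ≠ 0 → ∀ m ∈ weightSpace d M (lam + k), p m = 0 := by
  have h := exists_proj_of_iSupIndep (weightSpace_iSupIndep d lam M) hM 0
  have e : lam + ((0 : ℤ) : K) = lam := by simp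
  beta_reduce at h
  rw [e] at h
  exact h

/-- The projection of a `λ`-Euler module onto its part of degree zero. -/
noncomputable def weightProj [CharZero K] (hM : IsEuler d lam M) :
    M →ₗ[degZero K d] weightSpace d M lam :=
  (exists_weightProj hM).choose

theorem weightProj_coe [CharZero K] (hM : IsEuler d lam M) (m : weightSpace d M lam) :
    weightProj hM (m : M) = m :=
  (exists_weightProj hM).choose_spec.1 m

theorem weightProj_of_ne [CharZero K] (hM : IsEuler d lam M) {k : ℤ} (hk : k ≠ 0) {m : M}
    (hm : m ∈ weightSpace d M (lam + k)) : weightProj hM m = 0 :=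
  (exists_weightProj hM).choose_spec.2 k hk m hm

/-- Two additive maps on a `λ`-Euler module agree if they agree on the weight vectors. -/
theorem IsEuler.addHom_ext {A : Type*} [AddCommGroup A] (hM : IsEuler d lam M) {f g : M →+ A}
    (h : ∀ k : ℤ, ∀ m ∈ weightSpace d M (lam + k), f m = g m) : f = g := by
  ext m
  have hm : m ∈ ⨆ k : ℤ, weightSpace d M (lam + k) := by rw [hM]; trivial
  induction hm using Submodule.iSup_induction' with
  | mem k m hm => exact h k m hm
  | zero => simp
  | add a b _ _ ha hb => rw [map_add, map_add, ha, hb]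

theorem map_mem_weightSpace {N : Type u} [AddCommGroup N] [Module (Weyl K n) N]
    (f : M →ₗ[Weyl K n] N) {μ : K} {m : M} (hm : m ∈ weightSpace d M μ) :
    f m ∈ weightSpace d N μ := by
  rw [mem_weightSpace] at hm ⊢
  rw [← map_smul, hm, map_smul]

theorem weightProj_map [CharZero K] {N : Type u} [AddCommGroup N] [Module (Weyl K n) N]
    (hM : IsEuler d lam M) (hN : IsEuler d lam N) (f : M →ₗ[Weyl K n] N) (m : M) :
    ((weightProj hN (f m) : weightSpace d N lam) : N) = f (weightProj hM m) := by
  have h := hM.addHom_ext (f := ((weightSpace d N lam).subtype.toAddMonoidHom.comp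
    (weightProj hN).toAddMonoidHom).comp f.toAddMonoidHom)
    (g := f.toAddMonoidHom.comp ((weightSpace d M lam).subtype.toAddMonoidHom.comp
    (weightProj hM).toAddMonoidHom)) ?_
  · exact DFunLike.congr_fun h m
  · intro k m hm
    change ((weightProj hN (f m) : weightSpace d N lam) : N) = f (weightProj hM m)
    by_cases hk : k = 0
    · subst hk
      have e : lam + ((0 : ℤ) : K) = lam := by simp
      rw [e] at hm
      rw [weightProj_coe hM ⟨m, hm⟩, weightProj_coe hN ⟨f m, map_mem_weightSpace f hm⟩]
    · rw [weightProj_of_ne hM hk hm, weightProj_of_ne hN hk (map_mem_weightSpace f hm)]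
      simp

theorem mem_iSup_weylPart (a : Weyl K n) : a ∈ ⨆ k, weylPart K d k := by
  obtain ⟨a, rfl⟩ := RingQuot.mkAlgHom_surjective K (WeylRel K n) a
  change Weyl.mk K n a ∈ _
  induction a using FreeAlgebra.induction with
  | grade0 r =>
    rw [AlgHom.commutes, Algebra.algebraMap_eq_smul_one]
    exact Submodule.smul_mem _ _ (Submodule.mem_iSup_of_mem 0 SetLike.GradedOne.one_mem)
  | grade1 s =>
    exact Submodule.mem_iSup_of_mem (genDeg d s)
      (Submodule.subset_span ⟨[s], by simp, by simp [gen]⟩)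
  | add a b ha hb => rw [map_add]; exact add_mem ha hb
  | mul a b ha hb =>
    rw [map_mul]
    have h := Submodule.mul_mem_mul ha hb
    rw [Submodule.iSup_mul] at h
    refine (iSup_le fun i => ?_ : _ ≤ ⨆ k, weylPart K d k) h
    rw [Submodule.mul_iSup]
    refine iSup_le fun j => Submodule.mul_le.2 fun u hu v hv => ?_
    exact Submodule.mem_iSup_of_mem (i + j) (SetLike.GradedMul.mul_mem hu hv)

theorem smul_mem_iSup_weightSpace (a : Weyl K n) {m : M}
    (hm : m ∈ ⨆ k : ℤ, weightSpace d M (lam + k)) :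
    a • m ∈ ⨆ k : ℤ, weightSpace d M (lam + k) := by
  have ha := mem_iSup_weylPart (d := d) a
  induction ha using Submodule.iSup_induction' with
  | mem j a ha =>
    induction hm using Submodule.iSup_induction' with
    | mem k m hm =>
      refine Submodule.mem_iSup_of_mem (k + j) ?_
      have := smul_mem_weightSpace d ha hm
      rwa [add_assoc, ← Int.cast_add] at this
    | zero => rw [smul_zero]; exact zero_mem _
    | add u v _ _ hu hv => rw [smul_add]; exact add_mem hu hv
  | zero => rw [zero_smul]; exact zero_mem _
  | add u v _ _ hu hv => rw [add_smul]; exact add_mem hu hv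

/-- Homogeneous operators shift weights by integers, so weight vectors generate a submodule that is
still a sum of weight spaces. -/
theorem IsEuler.span (S : Submodule (Weyl K n) M)
    (hS : S = Submodule.span (Weyl K n) (⋃ k : ℤ, (weightSpace d M (lam + k) : Set M))) :
    IsEuler d lam S := by
  rw [IsEuler, eq_top_iff]
  rintro ⟨m, hmS⟩ -
  have hm := hmS
  rw [hS] at hm
  induction hm using Submodule.span_induction with
  | mem m hm =>
    obtain ⟨k, hk⟩ := Set.mem_iUnion.1 hm
    exact Submodule.mem_iSup_of_mem k (Subtype.ext hk)
  | zero => exact zero_mem _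
  | add a b ha hb iha ihb =>
    rw [← hS] at ha hb
    exact add_mem (iha ha) (ihb hb)
  | smul c a ha iha =>
    rw [← hS] at ha
    exact smul_mem_iSup_weightSpace c (iha ha)

theorem IsEuler.quotient (hM : IsEuler d lam M) (N : Submodule (Weyl K n) M) :
    IsEuler d lam (M ⧸ N) := by
  rw [IsEuler, eq_top_iff]
  rintro y -
  obtain ⟨m, rfl⟩ := N.mkQ_surjective y
  have hm : m ∈ ⨆ k : ℤ, weightSpace d M (lam + k) := by rw [hM]; trivial
  induction hm using Submodule.iSup_induction' with
  | mem k m hm => exact Submodule.mem_iSup_of_mem k (map_mem_weightSpace _ hm)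
  | zero => rw [map_zero]; exact zero_mem _
  | add a b _ _ ha hb => rw [map_add]; exact add_mem ha hb

theorem IsEuler.ker [CharZero K] {N : Type u} [AddCommGroup N] [Module (Weyl K n) N]
    (hM : IsEuler d lam M) (f : M →ₗ[Weyl K n] N) : IsEuler d lam (LinearMap.ker f) := by
  classical
  rw [IsEuler, eq_top_iff]
  rintro ⟨m, hm0⟩ -
  have hm : m ∈ ⨆ k : ℤ, weightSpace d M (lam + k) := by rw [hM]; trivial
  obtain ⟨c, hc⟩ := (Submodule.mem_iSup_iff_exists_finsupp _ _).1 hm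
  obtain ⟨hc, rfl⟩ := hc
  -- The images of the components lie in independent weight spaces and sum to zero, so each one
  -- vanishes: a kernel contains the weight components of its elements.
  have hz : ∀ k ∈ c.support, f (c k) = 0 := by
    have h1 := weightSpace_iSupIndep d lam N
    rw [iSupIndep_iff_finsetSum_eq_zero_imp_eq_zero] at h1
    refine h1 c.support (fun k => f (c k)) (fun k _ => map_mem_weightSpace f (hc k)) ?_
    rw [← map_sum]
    exact hm0
  have hz' : ∀ k, c k ∈ LinearMap.ker f := by
    intro k
    by_cases hk : k ∈ c.support
    · exact hz k hk
    · rw [Finsupp.notMem_support_iff.1 hk]; exact zero_mem _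
  have e : (⟨c.sum fun _ xi => xi, hm0⟩ : LinearMap.ker f) =
      ∑ k ∈ c.support, (⟨c k, hz' k⟩ : LinearMap.ker f) := by
    apply Subtype.ext
    simp [Finsupp.sum]
  rw [e]
  refine sum_mem fun k _ => Submodule.mem_iSup_of_mem k ?_
  exact Subtype.ext (hc k)

end Projection

/-! ### The morphisms inverted by `M ↦ M^λ` -/

section Inverted

variable {K : Type u} [Field K] [CharZero K] {n : ℕ} (d : Fin (n + 1) → ℕ) (lam : K)

theorem isTorsionModule_iff
    (hd : ∀ i, 0 < d i) (hgcd : Finset.univ.gcd d = 1)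
    (hlam : lam ∉ Set.range (Int.cast : ℤ → K) ∨ lam ∈ weightSemigroup K d)
    {M : Type u} [AddCommGroup M] [Module (Weyl K n) M]
    (hM : IsEuler d lam M) : IsTorsionModule (K := K) d M ↔ weightSpace d M lam = ⊥ :=
  ⟨weightSpace_eq_bot_of_isTorsionModule d hd hlam,
    isTorsionModule_of_weightSpace_eq_bot d hd hlam hgcd hM⟩

/-- Taking `M^λ` is exact, so bijectivity there means that the kernel and the cokernel have no part
of weight `λ`. Right exactness comes from `weightProj`, which commutes with `D`-linear maps and so
corrects an arbitrary lift to one of weight `λ`. -/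
theorem bijective_weightMap_iff
    (hd : ∀ i, 0 < d i) (hgcd : Finset.univ.gcd d = 1)
    (hlam : lam ∉ Set.range (Int.cast : ℤ → K) ∨ lam ∈ weightSemigroup K d)
    {M N : Type u} [AddCommGroup M] [Module (Weyl K n) M]
    [AddCommGroup N] [Module (Weyl K n) N] (hM : IsEuler d lam M) (hN : IsEuler d lam N)
    (f : M →ₗ[Weyl K n] N) :
    Function.Bijective (weightMap d lam f) ↔
      IsTorsionModule (K := K) d (LinearMap.ker f) ∧
        IsTorsionModule (K := K) d (N ⧸ LinearMap.range f) := by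
  rw [isTorsionModule_iff d lam hd hgcd hlam (hM.ker f),
    isTorsionModule_iff d lam hd hgcd hlam (hN.quotient _), Function.Bijective]
  refine and_congr ?_ ?_
  · rw [injective_iff_map_eq_zero, eq_bot_iff]
    constructor
    · rintro h ⟨m, hm⟩ hmw
      have hmw' : m ∈ weightSpace d M lam := congrArg Subtype.val hmw
      have := h ⟨m, hmw'⟩ (Subtype.ext hm)
      have h2 : m = 0 := congrArg Subtype.val this
      exact Subtype.ext h2
    · rintro h ⟨m, hmw⟩ hm
      have hm' : m ∈ LinearMap.ker f := congrArg Subtype.val hm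
      have : (⟨m, hm'⟩ : LinearMap.ker f) ∈ weightSpace d (LinearMap.ker f) lam :=
        Subtype.ext hmw
      have h2 : m = 0 := congrArg Subtype.val ((Submodule.mem_bot _).1 (h this))
      exact Subtype.ext h2
  · rw [eq_bot_iff]
    constructor
    · intro h y hy
      obtain ⟨m, rfl⟩ := (LinearMap.range f).mkQ_surjective y
      have h1 := weightProj_map hN (hN.quotient (LinearMap.range f)) (LinearMap.range f).mkQ m
      rw [weightProj_coe (hN.quotient (LinearMap.range f)) ⟨_, hy⟩] at h1
      obtain ⟨z, hz⟩ := h (weightProj hN m)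
      change (LinearMap.range f).mkQ m = 0
      change (LinearMap.range f).mkQ m = _ at h1
      rw [h1]
      exact (Submodule.Quotient.mk_eq_zero _).2 ⟨z, congrArg Subtype.val hz⟩
    · rintro h ⟨y, hy⟩
      have h1 := h (map_mem_weightSpace (LinearMap.range f).mkQ hy)
      obtain ⟨m, rfl⟩ := (Submodule.Quotient.mk_eq_zero _).1 h1
      refine ⟨weightProj hM m, Subtype.ext ?_⟩
      change f (weightProj hM m) = f m
      rw [← weightProj_map hM hN, weightProj_coe hN ⟨_, hy⟩]

theorem isoModTorsion_eq
    (hd : ∀ i, 0 < d i) (hgcd : Finset.univ.gcd d = 1)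
    (hlam : lam ∉ Set.range (Int.cast : ℤ → K) ∨ lam ∈ weightSemigroup K d)
    :
    isoModTorsion d lam =
      (MorphismProperty.isomorphisms _).inverseImage (degZeroFunctor d lam) := by
  ext M N f
  rw [MorphismProperty.inverseImage_iff, MorphismProperty.isomorphisms.iff,
    ConcreteCategory.isIso_iff_bijective]
  exact (bijective_weightMap_iff d lam hd hgcd hlam M.property N.property f.hom.hom).symm

end Inverted

/-! ### The grading of the Weyl algebra -/

section DegreeZero

variable {K : Type u} [Field K] {n : ℕ} (d : Fin (n + 1) → ℕ)

/-- The homogeneous component `D_k` as a left `D_0`-module. -/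
noncomputable def weylPartLeft (k : ℤ) : Submodule (degZero K d) (Weyl K n) where
  carrier := weylPart K d k
  zero_mem' := zero_mem _
  add_mem' := add_mem
  smul_mem' a b hb := by
    have h : (a : Weyl K n) * b ∈ weylPart K d (0 + k) := SetLike.GradedMul.mul_mem a.2 hb
    rwa [zero_add] at h

theorem iSup_weylPartLeft : ⨆ k, weylPartLeft (K := K) d k = ⊤ := by
  rw [eq_top_iff]
  rintro a -
  have ha := mem_iSup_weylPart (d := d) a
  induction ha using Submodule.iSup_induction' with
  | mem k a ha => exact Submodule.mem_iSup_of_mem k ha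
  | zero => exact zero_mem _
  | add u v _ _ hu hv => exact add_mem hu hv

/-- `D_k` lies in the eigenspace of `[E, ·]` for the eigenvalue `k`, and these eigenvalues are
distinct in characteristic zero. -/
theorem weylPartLeft_iSupIndep [CharZero K] : iSupIndep (weylPartLeft (K := K) d) := by
  refine iSupIndep_of_eigen (K := K)
    (LinearMap.mulLeft K (euler K d) - LinearMap.mulRight K (euler K d))
    (μ := fun k : ℤ => (k : K)) Int.cast_injective _ fun k a ha => ?_
  have h := euler_mul_of_mem K d k (a := a) ha
  simp only [LinearMap.sub_apply, LinearMap.mulLeft_apply, LinearMap.mulRight_apply, h,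
    add_sub_cancel_left, Algebra.smul_def, map_intCast]

theorem exists_degZeroProj [CharZero K] :
    ∃ p : Weyl K n →ₗ[degZero K d] degZero K d, (∀ a : degZero K d, p (a : Weyl K n) = a) ∧
      ∀ k : ℤ, k ≠ 0 → ∀ a ∈ weylPart K d k, p a = 0 := by
  obtain ⟨p, h1, h2⟩ :=
    exists_proj_of_iSupIndep (weylPartLeft_iSupIndep (K := K) d) (iSup_weylPartLeft d) 0
  exact ⟨{ toFun := fun a => ⟨p a, (p a).2⟩
           map_add' := fun a b => Subtype.ext (by simp)
           map_smul' := fun a b => Subtype.ext (congrArg Subtype.val (map_smul p a b)) },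
    fun a => Subtype.ext (congrArg Subtype.val (h1 ⟨a, a.2⟩)),
    fun k hk a ha => Subtype.ext (congrArg Subtype.val (h2 k hk a ha))⟩

variable {d} in
/-- Two additive maps on the Weyl algebra agree if they agree on homogeneous elements. -/
theorem weyl_addHom_ext {A : Type*} [AddCommGroup A] {f g : Weyl K n →+ A}
    (h : ∀ k : ℤ, ∀ a ∈ weylPart K d k, f a = g a) : f = g := by
  ext a
  have ha := mem_iSup_weylPart (d := d) a
  induction ha using Submodule.iSup_induction' with
  | mem k a ha => exact h k a ha
  | zero => simp
  | add u v _ _ hu hv => rw [map_add, map_add, hu, hv]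

end DegreeZero

/-! ### The coinduced module and its Euler part -/

section Coinduced

variable {K : Type u} [Field K] {n : ℕ} (d : Fin (n + 1) → ℕ) (lam : K)
  (N : Type u) [AddCommGroup N] [Module (TwistedOps d lam) N]

/-- The left `D_0`-linear maps from the Weyl algebra to a module over the twisted operators. -/
def coind : AddSubgroup (Weyl K n →+ N) where
  carrier := {f | ∀ (a : degZero K d) (b : Weyl K n),
    f (a * b) = Ideal.Quotient.mk (twistIdeal d lam) a • f b}
  zero_mem' := by simp
  add_mem' {f g} hf hg a b := by simp [hf a b, hg a b]
  neg_mem' {f} hf a b := by simp [hf a b]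

variable {d lam N}

theorem coind_apply (f : coind d lam N) (a : degZero K d) (b : Weyl K n) :
    f.1 (a * b) = Ideal.Quotient.mk (twistIdeal d lam) a • f.1 b := f.2 a b

/-- The coinduced module structure, by right multiplication on the argument. -/
noncomputable instance : Module (Weyl K n) (coind d lam N) where
  smul c f := ⟨f.1.comp (AddMonoidHom.mulRight c), fun a b => by
    simp [mul_assoc, coind_apply]⟩
  one_smul f := Subtype.ext (AddMonoidHom.ext fun b => congrArg f.1 (mul_one b))
  mul_smul a c f := Subtype.ext (AddMonoidHom.ext fun b => congrArg f.1 (mul_assoc b a c).symm)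
  smul_zero c := rfl
  smul_add c f g := rfl
  add_smul a c f := Subtype.ext (AddMonoidHom.ext fun b =>
    (congrArg f.1 (mul_add b a c)).trans (map_add f.1 _ _))
  zero_smul f := Subtype.ext (AddMonoidHom.ext fun b =>
    (congrArg f.1 (mul_zero b)).trans (map_zero f.1))

theorem coind_smul_apply (c : Weyl K n) (f : coind d lam N) (b : Weyl K n) :
    (c • f).1 b = f.1 (b * c) := rfl

theorem coind_algebraMap_mul (f : coind d lam N) (c : K) (b : Weyl K n) :
    f.1 (algebraMap K (Weyl K n) c * b) = algebraMap K (TwistedOps d lam) c • f.1 b :=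
  coind_apply f (algebraMap K (degZero K d) c) b

variable (d lam) in
theorem mk_eulerZero : Ideal.Quotient.mk (twistIdeal d lam) (eulerZero K d) =
    algebraMap K (TwistedOps d lam) lam := by
  refine Ideal.Quotient.eq.2 (Ideal.subset_span ?_)
  rfl

theorem coind_euler_mul (f : coind d lam N) (b : Weyl K n) :
    f.1 (euler K d * b) = algebraMap K (TwistedOps d lam) lam • f.1 b := by
  rw [← mk_eulerZero]
  exact coind_apply f (eulerZero K d) b

theorem mem_weightSpace_coind {f : coind d lam N} {μ : K} :
    f ∈ weightSpace d (coind d lam N) μ ↔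
      ∀ b, f.1 (b * euler K d) = algebraMap K (TwistedOps d lam) μ • f.1 b := by
  rw [mem_weightSpace, Subtype.ext_iff, DFunLike.ext_iff]
  refine forall_congr' fun b => ?_
  rw [coind_smul_apply, coind_smul_apply, ← Algebra.commutes, coind_algebraMap_mul]

theorem algebraMap_twistedOps_smul_eq_zero {c : K} (hc : c ≠ 0) {y : N}
    (h : algebraMap K (TwistedOps d lam) c • y = 0) : y = 0 := by
  have h1 := congrArg (fun y => algebraMap K (TwistedOps d lam) c⁻¹ • y) h
  simpa only [← mul_smul, ← map_mul, inv_mul_cancel₀ hc, map_one, one_smul, smul_zero] using h1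

/-- An element of weight `λ + k` of the coinduced module vanishes on `D_j` for `j + k ≠ 0`. -/
theorem coind_apply_eq_zero [CharZero K] {f : coind d lam N} {k j : ℤ} (hkj : j + k ≠ 0)
    (hf : f ∈ weightSpace d (coind d lam N) (lam + k)) {b : Weyl K n}
    (hb : b ∈ weylPart K d j) : f.1 b = 0 := by
  have h1 := mem_weightSpace_coind.1 hf b
  -- Since `b E = (E - j) b` and `E` acts on values as `λ`, the weight condition reads `(λ - j) f(b)
  -- = (λ + k) f(b)`.
  have h2 : b * euler K d = euler K d * b - algebraMap K (Weyl K n) j * b := by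
    rw [euler_mul_of_mem K d j hb, map_intCast, add_sub_cancel_right]
  rw [h2, map_sub, coind_euler_mul, coind_algebraMap_mul, ← sub_smul, ← map_sub, ← sub_eq_zero,
    ← sub_smul, ← map_sub] at h1
  refine algebraMap_twistedOps_smul_eq_zero ?_ h1
  intro h3
  apply hkj
  have h4 : ((j + k : ℤ) : K) = 0 := by push_cast; linear_combination -h3
  exact_mod_cast h4

variable (d lam N) in
/-- The sum of the weight spaces of the coinduced module. -/
noncomputable def eulerCoind : Submodule (Weyl K n) (coind d lam N) :=
  Submodule.span (Weyl K n) (⋃ k : ℤ, (weightSpace d (coind d lam N) (lam + k) : Set _))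

variable (d lam N) in
theorem isEuler_eulerCoind : IsEuler d lam (eulerCoind d lam N) := IsEuler.span _ rfl

variable (d lam N) in
/-- Evaluation at `1` on the part of degree zero. -/
noncomputable def eulerCoindEval :
    weightSpace d (eulerCoind d lam N) lam →ₗ[TwistedOps d lam] N where
  toFun f := f.1.1.1 1
  map_add' f g := rfl
  map_smul' a f := by
    obtain ⟨a, rfl⟩ := Ideal.Quotient.mk_surjective a
    change f.1.1.1 (1 * (a : Weyl K n)) = _
    rw [one_mul, ← mul_one (a : Weyl K n), coind_apply]
    rfl

/-- A map of weight `λ` vanishes off `D_0`, and on `D_0` linearity determines it by its value at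
`1`. Conversely `y` comes from `b ↦ p(b) y`, with `p` the projection of the Weyl algebra onto `D_0`.
-/
theorem eulerCoindEval_bijective [CharZero K] : Function.Bijective (eulerCoindEval d lam N) := by
  have e : lam + ((0 : ℤ) : K) = lam := by simp
  constructor
  · rw [injective_iff_map_eq_zero]
    rintro ⟨⟨f, hfS⟩, hf⟩ h0
    have hf : f ∈ weightSpace d (coind d lam N) lam := congrArg Subtype.val hf
    change f.1 1 = 0 at h0
    suffices h : f = 0 by subst h; rfl
    refine Subtype.ext (weyl_addHom_ext (d := d) fun k b hb => ?_)
    change f.1 b = 0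
    by_cases hk : k = 0
    · subst hk
      have h1 := coind_apply f ⟨b, hb⟩ 1
      rw [h0, smul_zero, mul_one] at h1
      exact h1
    · refine coind_apply_eq_zero (k := 0) (by simpa using hk) ?_ hb
      rw [e]
      exact hf
  · intro y
    obtain ⟨p, hp1, hp2⟩ := exists_degZeroProj (K := K) d
    let f : coind d lam N := ⟨
      { toFun := fun b => Ideal.Quotient.mk (twistIdeal d lam) (p b) • y
        map_zero' := by simp
        map_add' := fun b c => by simp [add_smul] }, fun a b => by
          have h : p ((a : Weyl K n) * b) = a * p b := p.map_smul a b
          change Ideal.Quotient.mk (twistIdeal d lam) (p (a * b)) • y = _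
          rw [h, map_mul, mul_smul]
          rfl⟩
    -- On `D_0` this holds because `E` is central and acts as `λ`; in the other degrees `p` kills
    -- both sides.
    have hf : f ∈ weightSpace d (coind d lam N) lam := by
      rw [mem_weightSpace_coind]
      intro b
      have h := weyl_addHom_ext (d := d) (f := f.1.comp (AddMonoidHom.mulRight (euler K d)))
        (g := f.1.comp (AddMonoidHom.mulLeft (algebraMap K (Weyl K n) lam))) ?_
      · have h1 := DFunLike.congr_fun h b
        change f.1 (b * euler K d) = f.1 (algebraMap K (Weyl K n) lam * b) at h1
        rw [h1, coind_algebraMap_mul]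
      · intro k b hb
        change f.1 (b * euler K d) = f.1 (algebraMap K (Weyl K n) lam * b)
        rw [coind_algebraMap_mul]
        by_cases hk : k = 0
        · subst hk
          have h1 := euler_mul_of_mem K d 0 hb
          rw [Int.cast_zero, zero_mul, add_zero] at h1
          rw [← h1, coind_euler_mul]
        · have h1 : b * euler K d ∈ weylPart K d (k + 0) :=
            SetLike.GradedMul.mul_mem hb (euler_mem K d)
          rw [add_zero] at h1
          change Ideal.Quotient.mk (twistIdeal d lam) (p (b * euler K d)) • y =
            algebraMap K (TwistedOps d lam) lam • Ideal.Quotient.mk (twistIdeal d lam) (p b) • y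
          rw [hp2 k hk _ h1, hp2 k hk _ hb]
          simp
    refine ⟨⟨⟨f, Submodule.subset_span (Set.mem_iUnion.2 ⟨0, ?_⟩)⟩, Subtype.ext hf⟩, ?_⟩
    · rw [e]; exact hf
    · change Ideal.Quotient.mk (twistIdeal d lam) (p 1) • y = y
      have h : p 1 = 1 := hp1 1
      rw [h, map_one, one_smul]

variable {M : Type u} [AddCommGroup M] [Module (Weyl K n) M]

/-- The map to the coinduced module determined by a map on the part of degree zero. -/
noncomputable def coindLift [CharZero K] (hM : IsEuler d lam M) (φ : weightSpace d M lam →ₗ[TwistedOps d lam] N) :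
    M →ₗ[Weyl K n] coind d lam N where
  toFun m := ⟨
    { toFun := fun b => φ (weightProj hM (b • m))
      map_zero' := by simp
      map_add' := fun b c => by simp [add_smul] }, fun a b => by
        change φ (weightProj hM ((a * b : Weyl K n) • m)) = _
        rw [mul_smul]
        change φ (weightProj hM (a • b • m)) = _
        rw [map_smul (weightProj hM) a (b • m), ← mk_smul_weightSpace, map_smul]
        rfl⟩
  map_add' m m' := Subtype.ext (AddMonoidHom.ext fun b => by
    change φ (weightProj hM (b • (m + m'))) = φ (weightProj hM (b • m)) + φ (weightProj hM (b • m'))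
    rw [smul_add, map_add, map_add])
  map_smul' c m := Subtype.ext (AddMonoidHom.ext fun b => by
    change φ (weightProj hM (b • c • m)) = φ (weightProj hM ((b * c) • m))
    rw [mul_smul])

/-- A map from a `λ`-Euler module to the coinduced module has values in the sum of the weight
spaces. -/
theorem mem_eulerCoind (hM : IsEuler d lam M) (f : M →ₗ[Weyl K n] coind d lam N) (m : M) :
    f m ∈ eulerCoind d lam N := by
  have hm : m ∈ ⨆ k : ℤ, weightSpace d M (lam + k) := by rw [hM]; trivial
  induction hm using Submodule.iSup_induction' with
  | mem k m hm =>
    exact Submodule.subset_span (Set.mem_iUnion.2 ⟨k, map_mem_weightSpace f hm⟩)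
  | zero => rw [map_zero]; exact zero_mem _
  | add a b _ _ ha hb => rw [map_add]; exact add_mem ha hb

/-- The universal property of `eulerCoind`. -/
noncomputable def eulerCoindEquiv [CharZero K] (hM : IsEuler d lam M) :
    (weightSpace d M lam →ₗ[TwistedOps d lam] N) ≃ (M →ₗ[Weyl K n] eulerCoind d lam N) where
  toFun φ := (coindLift hM φ).codRestrict _ (mem_eulerCoind hM _)
  invFun g := eulerCoindEval d lam N ∘ₗ weightMap d lam g
  left_inv φ := by
    ext m
    change φ (weightProj hM ((1 : Weyl K n) • (m : M))) = φ m
    rw [one_smul, weightProj_coe]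
  right_inv g := by
    -- Evaluation at `1 ∈ D_0` sees only the component of weight `λ`. Applied to `b • m`, this
    -- recovers `g m` at every `b`.
    have key : ∀ m : M, (g (weightProj hM m : M)).1.1 1 = (g m).1.1 1 := by
      have h := hM.addHom_ext
        (f := ((AddMonoidHom.eval (1 : Weyl K n)).comp
          ((coind d lam N).subtype.comp ((eulerCoind d lam N).subtype.comp g).toAddMonoidHom)).comp
          ((weightSpace d M lam).subtype.toAddMonoidHom.comp (weightProj hM).toAddMonoidHom))
        (g := (AddMonoidHom.eval (1 : Weyl K n)).comp
          ((coind d lam N).subtype.comp ((eulerCoind d lam N).subtype.comp g).toAddMonoidHom)) ?_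
      · exact fun m => DFunLike.congr_fun h m
      · intro k m hm
        change (g (weightProj hM m : M)).1.1 1 = (g m).1.1 1
        by_cases hk : k = 0
        · subst hk
          have e : lam + ((0 : ℤ) : K) = lam := by simp
          rw [e] at hm
          rw [weightProj_coe hM ⟨m, hm⟩]
        · rw [weightProj_of_ne hM hk hm]
          have h1 := map_mem_weightSpace ((eulerCoind d lam N).subtype.comp g) hm
          have h2 := coind_apply_eq_zero (j := 0) (by simpa using hk) h1
            (SetLike.GradedOne.one_mem (A := weylPart K d))
          rw [Submodule.coe_zero, map_zero]
          exact h2.symm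
    refine LinearMap.ext fun m => Subtype.ext (Subtype.ext (AddMonoidHom.ext fun b => ?_))
    change (g (weightProj hM (b • m) : M)).1.1 1 = (g m).1.1 b
    rw [key, map_smul]
    change (g m).1.1 (1 * b) = _
    rw [one_mul]

end Coinduced

/-! ### The adjunction between `M ↦ M^λ` and coinduction -/

section Adjunction

variable {K : Type u} [Field K] [CharZero K] {n : ℕ} (d : Fin (n + 1) → ℕ) (lam : K)

/-- The universal property of `eulerCoind` in terms of categories. -/
noncomputable def eulerCoindHomEquiv (M : EulerMod d lam) (N : ModuleCat.{u} (TwistedOps d lam)) :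
    ((degZeroFunctor d lam).obj M ⟶ N) ≃
      (M ⟶ (⟨ModuleCat.of _ (eulerCoind d lam N), isEuler_eulerCoind d lam N⟩ : EulerMod d lam)) where
  toFun φ := ObjectProperty.homMk (ModuleCat.ofHom (eulerCoindEquiv M.property φ.hom))
  invFun g := ModuleCat.ofHom ((eulerCoindEquiv M.property).symm g.hom.hom)
  left_inv φ := ModuleCat.hom_ext ((eulerCoindEquiv M.property).left_inv φ.hom)
  right_inv g := by
    ext1
    exact ModuleCat.hom_ext ((eulerCoindEquiv M.property).right_inv g.hom.hom)

theorem eulerCoindHomEquiv_symm (M : EulerMod d lam) (N : ModuleCat.{u} (TwistedOps d lam))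
    (g) : (eulerCoindHomEquiv d lam M N).symm g =
      (degZeroFunctor d lam).map g ≫ ModuleCat.ofHom (eulerCoindEval d lam N) := rfl

/-- Naturality is immediate for the inverse bijection, which applies `degZeroFunctor` and then
composes with evaluation at `1`. -/
theorem eulerCoindHomEquiv_naturality (M' M : EulerMod d lam)
    (N : ModuleCat.{u} (TwistedOps d lam)) (f : M' ⟶ M) (g : (degZeroFunctor d lam).obj M ⟶ N) :
    eulerCoindHomEquiv d lam M' N ((degZeroFunctor d lam).map f ≫ g) =
      f ≫ eulerCoindHomEquiv d lam M N g := by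
  rw [← Equiv.eq_symm_apply, eulerCoindHomEquiv_symm]
  have h := eulerCoindHomEquiv_symm d lam M N (eulerCoindHomEquiv d lam M N g)
  rw [Equiv.symm_apply_apply] at h
  exact congrArg (fun z => (degZeroFunctor d lam).map f ≫ z) h

/-- The right adjoint of the functor `M ↦ M^λ`. -/
noncomputable def eulerCoindFunctor : ModuleCat.{u} (TwistedOps d lam) ⥤ EulerMod d lam :=
  Adjunction.rightAdjointOfEquiv _ (eulerCoindHomEquiv_naturality d lam)

/-- The adjunction between `M ↦ M^λ` and `eulerCoind`. -/
noncomputable def degZeroAdjunction : degZeroFunctor d lam ⊣ eulerCoindFunctor d lam :=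
  Adjunction.adjunctionOfEquivRight _ (eulerCoindHomEquiv_naturality d lam)

theorem isIso_degZeroAdjunction_counit : IsIso (degZeroAdjunction d lam).counit := by
  have (N : ModuleCat.{u} (TwistedOps d lam)) : IsIso ((degZeroAdjunction d lam).counit.app N) := by
    have h : (degZeroAdjunction d lam).counit.app N =
        ModuleCat.ofHom (eulerCoindEval d lam N) := by
      rw [degZeroAdjunction, Adjunction.adjunctionOfEquivRight_counit_app]
      rfl
    have h' : IsIso (ModuleCat.ofHom (eulerCoindEval d lam N)) :=
      (ConcreteCategory.isIso_iff_bijective _).2 eulerCoindEval_bijective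
    rw [h]
    exact h'
  exact NatIso.isIso_of_isIso_app _

end Adjunction

end WeightedDMod

/-! ### Comparison of the two localizations -/

theorem mainTheorem1 {K : Type u} [Field K] [CharZero K] {n : ℕ} (hn : 1 ≤ n)
    (d : Fin (n + 1) → ℕ) (hd : ∀ i, 0 < d i) (hgcd : Finset.univ.gcd d = 1)
    (lam : K)
    (hlam : lam ∉ Set.range (Int.cast : ℤ → K) ∨ lam ∈ WeightedDMod.weightSemigroup K d) :
    (WeightedDMod.quotientFunctor d lam).IsLeftAdjoint ∧
      ∀ (ω : WeightedDMod.TwistedDMod d lam ⥤ WeightedDMod.EulerMod d lam)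
        (adj : WeightedDMod.quotientFunctor d lam ⊣ ω),
        (WeightedDMod.globalSections d lam ω adj).IsEquivalence := by
  open WeightedDMod in
  let W := isoModTorsion d lam
  let F := degZeroFunctor d lam
  let H := eulerCoindFunctor d lam
  let adjH : F ⊣ H := degZeroAdjunction d lam
  have hcounit : IsIso adjH.counit := isIso_degZeroAdjunction_counit d lam
  have hff : H.FullyFaithful := adjH.fullyFaithfulROfIsIsoCounit
  have := hff.full
  have := hff.faithful
  -- A left adjoint with fully faithful right adjoint is a localization at the maps it inverts, and
  -- these are the maps of `W`.
  have hloc : F.IsLocalization W := by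
    have := adjH.isLocalization
    rwa [← isoModTorsion_eq d lam hd hgcd hlam] at this
  let e := Localization.uniq W.Q F W
  let i : F ⋙ e.inverse ≅ W.Q := Localization.compUniqInverse W.Q F W
  -- The quotient functor is `F` followed by an equivalence, so its right adjoint is obtained from
  -- `H`.
  have adjQ : W.Q ⊣ e.functor ⋙ H :=
    (adjH.comp e.symm.toAdjunction).ofNatIsoLeft i
  refine ⟨adjQ.isLeftAdjoint, fun ω adj => ?_⟩
  -- Any section functor agrees with `e.functor ⋙ H` by uniqueness of adjoints, and the invertible
  -- counit cancels `H ⋙ F`.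
  let j : globalSections d lam ω adj ≅ e.functor :=
    Functor.isoWhiskerRight (adj.rightAdjointUniq adjQ) F ≪≫
      Functor.associator _ _ _ ≪≫ Functor.isoWhiskerLeft e.functor (asIso adjH.counit) ≪≫
      Functor.rightUnitor _
  exact Functor.isEquivalence_of_iso j.symm
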